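/- Let $B$ be a compact (Hausdorff, finite-dimensional) topological manifold, possibly empty or disconnected, and possibly with boundary or corners, and let $G$ be a finite group. Let $\Pi_1(B)$ be the fundamental groupoid of $B$ and regard $G$ as a groupoid with one object. Let $[\Pi_1(B),G]$ be the category of flat $G$-connections on $B$: its objects are the functors $\Pi_1(B)\to G$ and its morphisms are the natural transformations between them (gauge transformations). Let $\mathrm{Vect}$ be the category of finite-dimensional complex vector spaces. Then the functor category $$Z_G(B)=\bigl[[\Pi_1(B),G],\mathrm{Vect}\bigr],$$ with its pointwise $\mathbb{C}$-linear structure, is a Kapranov--Voevodsky 2-vector space. That is, it has finite biproducts, and there are finitely many objects $S_1,\dots,S_k$ ($k\ge 0$) which are simple, i.e. $\hom(S_i,S_i)\cong\mathbb{C}$ as complex vector spaces, with $\hom(S_i,S_j)=0$ for $i\ne j$, such that every object is isomorphic to a finite (possibly empty) biproduct $S_{a_1}\oplus\dots\oplus S_{a_n}$ of these objects. -/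

import Mathlib

open CategoryTheory CategoryTheory.Limits

/-- An object `x` of a `ℂ`-linear category is simple when `hom(x, x) ≅ ℂ`. -/
def IsSimpleObject {V : Type*} [Category V] [Preadditive V] [Linear ℂ V] (x : V) : Prop :=
  Nonempty ((x ⟶ x) ≃ₗ[ℂ] ℂ)

/-- A Kapranov–Voevodsky 2-vector space: a `ℂ`-linear additive category (composition is bilinear
and finite biproducts exist) with a finite basis of simple objects, pairwise without nonzero
morphisms between them, such that every object is a finite biproduct of basis objects. -/
structure IsKV2VectorSpace (V : Type*) [Category V] [Preadditive V] [Linear ℂ V] : Prop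
    extends HasFiniteBiproducts V where
  exists_basis : ∃ (k : ℕ) (S : Fin k → V),
    (∀ i, IsSimpleObject (S i)) ∧
    (∀ i j, i ≠ j → ∀ f : S i ⟶ S j, f = 0) ∧
    ∀ x : V, ∃ (n : ℕ) (a : Fin n → Fin k), Nonempty (x ≅ ⨁ fun m => S (a m))

/-- The category `[Π₁(B), G]` of flat `G`-connections on `B` and gauge transformations: functors
from the fundamental groupoid of `B` to `G`, seen as a one-object groupoid, and natural
transformations. -/
abbrev FlatConnection (B : Type*) [TopologicalSpace B] (G : Type*) [Group G] :=
  FundamentalGroupoid B ⥤ SingleObj G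

/-- `Z_G(B) = [[Π₁(B), G], Vect]`, where `Vect` is the category of finite-dimensional complex
vector spaces. Its `ℂ`-linear structure is the pointwise one. -/
abbrev ZG (G : Type*) [Group G] (B : Type*) [TopologicalSpace B] :=
  FlatConnection B G ⥤ FGModuleCat.{0} ℂ

/-!
The category of flat connections is a groupoid; it suffices that its hom sets and its set of
isomorphism classes are finite, because the finite-dimensional representations of such a groupoid
are semisimple with finitely many simple objects.

*Finiteness.* A chart identifies a neighbourhood of a point of `B` with a relatively open part of a
convex set, so `B` has arbitrarily small simply connected open sets
(`exists_isSimplyConnected_subset_of_chartedSpace`). By compactness and the Lebesgue number lemma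
there is a finite cover by such sets `U i` in which two overlapping members lie in a common simply
connected set (`exists_finite_cover_isSimplyConnected`). Choose a base point in each `U i`. For
overlapping `U i` and `U j` there is then a canonical morphism of `Π₁(B)` between their base points,
whichever point of the overlap it is routed through. Every morphism of `Π₁(B)` is a composite of
paths inside single members, so a functor `Π₁(B) ⥤ G` is determined up to isomorphism by the values
in `G` of these finitely many canonical morphisms, and a natural transformation by its values at the
base points (`FlatConnection.exists_finite_representatives`). No presentation of the fundamental
groups is needed.

*Semisimplicity.* Averaging pointwise retractions over the groupoid splits every monomorphism of
representations (`isSplitMono_functor_of_finite`). Splitting off subobjects lowers the dimension of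
the endomorphism ring, so every object is a finite biproduct of simple objects
(`exists_iso_biproduct_simple`), and Schur's lemma computes the morphisms between these. A simple
representation receives a nonzero morphism from the linearisation of a corepresentable functor
(`exists_freeCoyoneda_hom_ne_zero`), so it is one of the finitely many constituents of those attached
to representatives of the isomorphism classes (`isKV2VectorSpace_of_isSplitMono`).
-/

/-! ### Simply connected neighbourhoods in a manifold -/

/-- In a manifold with corners every neighbourhood of a point contains an open simply connected
one: the range of the model is convex, so a small ball of the model space meets it in a convex
set. -/
theorem exists_isSimplyConnected_subset_of_chartedSpace {E : Type*} [NormedAddCommGroup E]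
    [NormedSpace ℝ E] {H : Type*} [TopologicalSpace H] (I : ModelWithCorners ℝ E H)
    {B : Type*} [TopologicalSpace B] [ChartedSpace H B] (x : B) {O : Set B} (hO : O ∈ nhds x) :
    ∃ U ⊆ O, IsOpen U ∧ x ∈ U ∧ IsSimplyConnected U := by
  have h1 : (extChartAt I x).symm ⁻¹' O ∩ (extChartAt I x).target ∈
      nhdsWithin (extChartAt I x x) (Set.range I) :=
    Filter.inter_mem (mem_nhdsWithin_of_mem_nhds (extChartAt_preimage_mem_nhds hO))
      (extChartAt_target_mem_nhdsWithin x)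
  obtain ⟨r, hr, hball⟩ := Metric.mem_nhdsWithin_iff.1 h1
  set ψ := extChartAt I x
  refine ⟨ψ.source ∩ ψ ⁻¹' Metric.ball (ψ x) r, ?_, ?_, ?_, ?_⟩
  · rintro y ⟨hy, hyb⟩
    have := (hball ⟨hyb, extChartAt_target_subset_range x (ψ.map_source hy)⟩).1
    simpa [ψ.left_inv hy] using this
  · exact isOpen_extChartAt_preimage' x Metric.isOpen_ball
  · exact ⟨mem_extChartAt_source x, Metric.mem_ball_self hr⟩
  · have hconv : Convex ℝ (Metric.ball (ψ x) r ∩ Set.range I) :=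
      (convex_ball _ _).inter I.convex_range
    have hne : (Metric.ball (ψ x) r ∩ Set.range I).Nonempty :=
      ⟨ψ x, Metric.mem_ball_self hr,
        extChartAt_target_subset_range x (ψ.map_source (mem_extChartAt_source x))⟩
    have := hconv.contractibleSpace hne
    let e : ↥(ψ.source ∩ ψ ⁻¹' Metric.ball (ψ x) r) ≃ₜ ↥(Metric.ball (ψ x) r ∩ Set.range I) :=
      { toFun := fun y => ⟨ψ y, y.2.2, extChartAt_target_subset_range x (ψ.map_source y.2.1)⟩
        invFun := fun z => ⟨ψ.symm z, ψ.map_target (hball z.2).2, by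
          simpa [ψ.right_inv (hball z.2).2] using z.2.1⟩
        left_inv := fun y => Subtype.ext (ψ.left_inv y.2.1)
        right_inv := fun z => Subtype.ext (ψ.right_inv (hball z.2).2)
        continuous_toFun := ((continuousOn_extChartAt x).comp_continuous continuous_subtype_val
          fun y => y.2.1).subtype_mk _
        continuous_invFun := ((continuousOn_extChartAt_symm x).comp_continuous
          continuous_subtype_val fun z => (hball z.2).2).subtype_mk _ }
    have := e.contractibleSpace
    exact SimplyConnectedSpace.ofContractible _

/-! ### Covers of a compact space by simply connected open sets -/

/-- In a compact Hausdorff space with arbitrarily small simply connected open sets there is a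
finite cover by such sets in which any two overlapping members lie in a common simply connected
set. -/
theorem exists_finite_cover_isSimplyConnected {X : Type*} [TopologicalSpace X] [T2Space X]
    [CompactSpace X]
    (hX : ∀ x : X, ∀ O ∈ nhds x, ∃ U ⊆ O, IsOpen U ∧ x ∈ U ∧ IsSimplyConnected U) :
    ∃ (n : ℕ) (U : Fin n → Set X), (∀ i, IsOpen (U i)) ∧ (∀ i, IsSimplyConnected (U i)) ∧
      (∀ x, ∃ i, x ∈ U i) ∧
      ∀ i j, (U i ∩ U j).Nonempty → ∃ W, IsSimplyConnected W ∧ U i ⊆ W ∧ U j ⊆ W := by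
  let _ : UniformSpace X := uniformSpaceOfCompactR1
  choose W _ hWo hWx hWs using fun x : X => hX x Set.univ Filter.univ_mem
  obtain ⟨V, hV, hVW⟩ := lebesgue_number_lemma (isCompact_univ (X := X)) hWo
    fun x _ => Set.mem_iUnion.2 ⟨x, hWx x⟩
  -- Points of one member of the cover are `V`-close, so all members through a point `z` lie in a
  -- member of `W` containing the `V`-ball at `z`.
  obtain ⟨A, hA, hAsymm, hAV⟩ := comp_symm_mem_uniformity_sets hV
  choose U hUA hUo hUx hUs using fun x : X =>
    hX x (UniformSpace.ball x A) (UniformSpace.ball_mem_nhds x hA)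
  obtain ⟨t, ht⟩ := (isCompact_univ (X := X)).elim_finite_subcover U hUo
    fun x _ => Set.mem_iUnion.2 ⟨x, hUx x⟩
  let e := t.equivFin.symm
  refine ⟨t.card, fun i => U (e i), fun i => hUo _, fun i => hUs _, fun x => ?_, ?_⟩
  · obtain ⟨a, ha, hxa⟩ := Set.mem_iUnion₂.1 (ht (Set.mem_univ x))
    exact ⟨e.symm ⟨a, ha⟩, by simpa using hxa⟩
  · rintro i j ⟨z, hzi, hzj⟩
    obtain ⟨w, hw⟩ := hVW z trivial
    have key : ∀ k, z ∈ U (e k) → U (e k) ⊆ W w := fun k hk y hy => hw <| hAV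
      ⟨_, SetRel.symm A (hUA _ hk), hUA _ hy⟩
    exact ⟨W w, hWs w, key i hzi, key j hzj⟩

/-! ### Morphisms of the fundamental groupoid carried by a subset -/

/-- The morphisms of the fundamental groupoid of `X` represented by a path inside `U`. -/
def pathsIn {X : Type*} [TopologicalSpace X] (U : Set X) :
    MorphismProperty (FundamentalGroupoid X) :=
  fun x y f => ∃ p : Path x.as y.as, Set.range p ⊆ U ∧ Path.Homotopic.Quotient.mk p = f

namespace pathsIn

variable {X : Type*} [TopologicalSpace X] {U W : Set X} {x y z : FundamentalGroupoid X}

theorem mono (h : U ⊆ W) {f : x ⟶ y} (hf : pathsIn U f) : pathsIn W f := by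
  obtain ⟨p, hp, rfl⟩ := hf
  exact ⟨p, hp.trans h, rfl⟩

theorem comp {f : x ⟶ y} {g : y ⟶ z} (hf : pathsIn U f) (hg : pathsIn U g) :
    pathsIn U (f ≫ g) := by
  obtain ⟨p, hp, rfl⟩ := hf
  obtain ⟨q, hq, rfl⟩ := hg
  exact ⟨p.trans q, by rw [Path.trans_range]; exact Set.union_subset hp hq, rfl⟩

theorem inv {f : x ⟶ y} (hf : pathsIn U f) : pathsIn U (Groupoid.inv f) := by
  obtain ⟨p, hp, rfl⟩ := hf
  exact ⟨p.symm, by rwa [Path.symm_range], rfl⟩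

theorem exists_of_isSimplyConnected (hU : IsSimplyConnected U) (hx : x.as ∈ U) (hy : y.as ∈ U) :
    ∃ f : x ⟶ y, pathsIn U f := by
  obtain ⟨p, hp⟩ := hU.isPathConnected.joinedIn _ hx _ hy
  exact ⟨Path.Homotopic.Quotient.mk p, p, Set.range_subset_iff.2 hp, rfl⟩

theorem eq_of_isSimplyConnected (hU : IsSimplyConnected U) {f g : x ⟶ y} (hf : pathsIn U f)
    (hg : pathsIn U g) : f = g := by
  obtain ⟨p, hp, rfl⟩ := hf
  obtain ⟨q, hq, rfl⟩ := hg
  have := hU.simplyConnectedSpace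
  have hpU := Set.range_subset_iff.1 hp
  have hqU := Set.range_subset_iff.1 hq
  let lift (r : Path x.as y.as) (hr : ∀ t, r t ∈ U) :
      Path (⟨x.as, by simpa using hpU 0⟩ : U) ⟨y.as, by simpa using hpU 1⟩ :=
    { toFun := fun t => ⟨r t, hr t⟩
      continuous_toFun := r.continuous.subtype_mk _
      source' := Subtype.ext r.source
      target' := Subtype.ext r.target }
  exact Quotient.sound
    ((SimplyConnectedSpace.paths_homotopic (lift p hpU) (lift q hqU)).map
      ⟨_, continuous_subtype_val⟩)

/-- A property of morphisms of the fundamental groupoid that is stable under composition and holds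
for paths inside a single member of an open cover holds for all morphisms: a path can be
subdivided. -/
theorem induction_of_open_cover {ι : Type*} {U : ι → Set X} (hUo : ∀ i, IsOpen (U i))
    (hU : ∀ x, ∃ i, x ∈ U i) (P : MorphismProperty (FundamentalGroupoid X))
    [P.IsStableUnderComposition] (hP : ∀ i, pathsIn (U i) ≤ P) (f : x ⟶ y) : P f := by
  obtain ⟨γ, rfl⟩ := Path.Homotopic.Quotient.mk_surjective f
  obtain ⟨t, ht0, htm, ⟨n, hn⟩, ht⟩ := exists_monotone_Icc_subset_open_cover_unitInterval
    (c := fun i => γ ⁻¹' U i) (fun i => (hUo i).preimage γ.continuous)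
    fun s _ => Set.mem_iUnion.2 (hU (γ s))
  have hstep : ∀ k, P (X := ⟨γ (t k)⟩) (Y := ⟨γ (t (k + 1))⟩)
      (Path.Homotopic.Quotient.mk (γ.subpath (t k) (t (k + 1)))) := fun k => by
    obtain ⟨i, hi⟩ := ht k
    refine hP i _ ⟨_, ?_, rfl⟩
    rw [Path.range_subpath_of_le _ _ _ (htm k.le_succ)]
    exact Set.image_subset_iff.2 hi
  have hall : ∀ k, P (X := ⟨γ (t 0)⟩) (Y := ⟨γ (t (k + 1))⟩)
      (Path.Homotopic.Quotient.mk (γ.subpath (t 0) (t (k + 1)))) := fun k => by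
    induction k with
    | zero => exact hstep 0
    | succ k ih =>
      have := P.comp_mem _ _ ih (hstep (k + 1))
      rwa [FundamentalGroupoid.comp_eq, ← Path.Homotopic.Quotient.mk_trans,
        Path.Homotopic.Quotient.eq.2 ⟨Path.Homotopy.subpathTransSubpath γ _ _ _⟩] at this
  have hcast : ∀ {a b a' b' : X} (p : Path a b) (ha : a' = a) (hb : b' = b),
      P (X := ⟨a'⟩) (Y := ⟨b'⟩) (Path.Homotopic.Quotient.mk (p.cast ha hb)) →
      P (X := ⟨a⟩) (Y := ⟨b⟩) (Path.Homotopic.Quotient.mk p) := by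
    rintro a b _ _ p rfl rfl h
    exact h
  have := hall n
  rw [ht0, hn (n + 1) n.le_succ, Path.subpath_zero_one] at this
  exact hcast γ _ _ this

end pathsIn

/-! ### Flat connections with finite gauge group -/

namespace FlatConnection

variable {B : Type*} [TopologicalSpace B] {G : Type*} [Group G]

/-- The holonomy of a flat connection along a morphism of the fundamental groupoid. -/
def holonomy (F : FlatConnection B G) {x y : FundamentalGroupoid B} (f : x ⟶ y) : G := F.map f

/-- Composition in `SingleObj G` is multiplication in the reverse order. -/
theorem holonomy_comp (F : FlatConnection B G) {x y z : FundamentalGroupoid B} (f : x ⟶ y)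
    (g : y ⟶ z) : F.holonomy (f ≫ g) = F.holonomy g * F.holonomy f :=
  F.map_comp f g

theorem holonomy_id (F : FlatConnection B G) (x : FundamentalGroupoid B) :
    F.holonomy (𝟙 x) = 1 :=
  F.map_id x

theorem holonomy_inv (F : FlatConnection B G) {x y : FundamentalGroupoid B} (f : x ⟶ y) :
    F.holonomy (Groupoid.inv f) = (F.holonomy f)⁻¹ := by
  rw [eq_inv_iff_mul_eq_one, ← holonomy_comp, Groupoid.comp_inv, holonomy_id]

/-- A gauge transformation, given by its values in `G`. -/
noncomputable def isoOfHolonomy {F F' : FlatConnection B G} (h : FundamentalGroupoid B → G)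
    (hh : ∀ {x y : FundamentalGroupoid B} (f : x ⟶ y),
      F'.holonomy f * h x = h y * F.holonomy f) : F ≅ F' :=
  NatIso.ofComponents
    (fun x =>
      { hom := (h x : G)
        inv := ((h x)⁻¹ : G)
        hom_inv_id := inv_mul_cancel (h x)
        inv_hom_id := mul_inv_cancel (h x) })
    fun f => (hh f).symm

/-- The value in `G` of a gauge transformation at a point. -/
def gaugeAt {F F' : FlatConnection B G} (η : F ⟶ F') (x : FundamentalGroupoid B) : G := η.app x

theorem gaugeAt_naturality {F F' : FlatConnection B G} (η : F ⟶ F') {x y : FundamentalGroupoid B}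
    (f : x ⟶ y) : gaugeAt η y * F.holonomy f = F'.holonomy f * gaugeAt η x :=
  η.naturality f

/-- If finitely many points meet every path component of `B`, a gauge transformation is determined
by its values in `G` at these points. -/
theorem finite_hom [Finite G] {ι : Type*} [Finite ι] (b : ι → FundamentalGroupoid B)
    (hb : ∀ y, ∃ i, Nonempty (b i ⟶ y)) (F F' : FlatConnection B G) : Finite (F ⟶ F') := by
  refine Finite.of_injective (fun (η : F ⟶ F') i => gaugeAt η (b i)) fun η η' h => ?_
  refine NatTrans.ext (funext fun y => ?_)
  obtain ⟨i, ⟨f⟩⟩ := hb y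
  have h1 := gaugeAt_naturality η f
  rw [show gaugeAt η (b i) = gaugeAt η' (b i) from congrFun h i, ← gaugeAt_naturality η' f] at h1
  exact mul_right_cancel h1

/-- Over a finite open cover by simply connected sets, overlapping members of which lie in a common
simply connected set, a flat connection is determined up to gauge transformation by its holonomies
between base points of overlapping members, which take finitely many values. -/
theorem exists_finite_representatives [Finite G] {n : ℕ} {U : Fin n → Set B}
    (hUo : ∀ i, IsOpen (U i)) (hUs : ∀ i, IsSimplyConnected (U i)) (hU : ∀ x, ∃ i, x ∈ U i)
    (hUU : ∀ i j, (U i ∩ U j).Nonempty → ∃ W, IsSimplyConnected W ∧ U i ⊆ W ∧ U j ⊆ W) :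
    (∀ F F' : FlatConnection B G, Finite (F ⟶ F')) ∧
      ∃ (m : ℕ) (R : Fin m → FlatConnection B G), ∀ F, ∃ j, Nonempty (F ≅ R j) := by
  choose b hb using fun i => (hUs i).nonempty
  choose c hc using fun (i : Fin n) (y : FundamentalGroupoid B) (hy : y.as ∈ U i) =>
    pathsIn.exists_of_isSimplyConnected (x := ⟨b i⟩) (hUs i) (hb i) hy
  choose idx hidx using fun y : FundamentalGroupoid B => hU y.as
  refine ⟨finite_hom (fun i => ⟨b i⟩) fun y => ⟨idx y, ⟨c _ y (hidx y)⟩⟩, ?_⟩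
  let ov := {p : Fin n × Fin n // (U p.1 ∩ U p.2).Nonempty}
  let φ : FlatConnection B G → ov → G := fun F p =>
    F.holonomy (c p.1.1 ⟨p.2.some⟩ p.2.some_mem.1 ≫
      Groupoid.inv (c p.1.2 ⟨p.2.some⟩ p.2.some_mem.2))
  -- The morphism between two base points through the overlap does not depend on the point of the
  -- overlap.
  have hφ : ∀ (F F' : FlatConnection B G), φ F = φ F' → ∀ (i j : Fin n)
      (y : FundamentalGroupoid B) (hi : y.as ∈ U i) (hj : y.as ∈ U j),
      F.holonomy (c i y hi ≫ Groupoid.inv (c j y hj)) =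
        F'.holonomy (c i y hi ≫ Groupoid.inv (c j y hj)) := by
    intro F F' h i j y hi hj
    obtain ⟨W, hW, hiW, hjW⟩ := hUU i j ⟨y.as, hi, hj⟩
    have hmem : ∀ (z : FundamentalGroupoid B) (hi : z.as ∈ U i) (hj : z.as ∈ U j),
        pathsIn W (c i z hi ≫ Groupoid.inv (c j z hj)) := fun z hi hj =>
      ((hc i z hi).mono hiW).comp ((hc j z hj).mono hjW).inv
    have := congrFun h ⟨(i, j), y.as, hi, hj⟩
    rwa [pathsIn.eq_of_isSimplyConnected hW (hmem y hi hj) (hmem ⟨_⟩ _ _)]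
  -- The gauge transformation compares parallel transport from the base point of a member of the
  -- cover; along a path inside one member, naturality is the equality of holonomies `hφ`.
  have hiso : ∀ F F' : FlatConnection B G, φ F = φ F' → Nonempty (F ≅ F') := by
    intro F F' h
    let g : FundamentalGroupoid B → G := fun y =>
      F'.holonomy (c (idx y) y (hidx y)) * (F.holonomy (c (idx y) y (hidx y)))⁻¹
    let P : MorphismProperty (FundamentalGroupoid B) := fun x y f =>
      F'.holonomy f * g x = g y * F.holonomy f
    have : P.IsStableUnderComposition := ⟨fun {x y z} f f' hf hf' => by
      change _ * _ = _ * _ at hf hf' ⊢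
      rw [holonomy_comp, holonomy_comp, mul_assoc, hf, ← mul_assoc, hf', mul_assoc]⟩
    refine ⟨isoOfHolonomy g fun f => pathsIn.induction_of_open_cover hUo hU P ?_ f⟩
    intro k x y f hf
    have hxk : x.as ∈ U k := by
      obtain ⟨p, hp, -⟩ := hf
      simpa using hp ⟨0, rfl⟩
    have hyk : y.as ∈ U k := by
      obtain ⟨p, hp, -⟩ := hf
      simpa using hp ⟨1, rfl⟩
    have hf' : f = Groupoid.inv (c k x hxk) ≫ c k y hyk :=
      pathsIn.eq_of_isSimplyConnected (hUs k) hf ((hc k x hxk).inv.comp (hc k y hyk))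
    have hx := hφ F F' h (idx x) k x (hidx x) hxk
    have hy := hφ F F' h k (idx y) y hyk (hidx y)
    change F'.holonomy f * g x = g y * F.holonomy f
    simp only [holonomy_comp, holonomy_inv] at hx hy
    simp only [hf', holonomy_comp, holonomy_inv, g]
    have alg : ∀ p q r s p' q' r' s' : G, p⁻¹ * q = p'⁻¹ * q' → r⁻¹ * s = r'⁻¹ * s' →
        s' * p'⁻¹ * (q' * q⁻¹) = r' * r⁻¹ * (s * p⁻¹) := fun p q r s p' q' r' s' h₁ h₂ =>
      calc s' * p'⁻¹ * (q' * q⁻¹) = s' * (p'⁻¹ * q') * q⁻¹ := by group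
        _ = r' * (r⁻¹ * s) * p⁻¹ := by rw [← h₁, h₂]; group
        _ = r' * r⁻¹ * (s * p⁻¹) := by group
    exact alg _ _ _ _ _ _ _ _ hx hy
  have := Fintype.ofFinite (Set.range φ)
  choose R hR using fun a : Set.range φ => a.2
  let e := Fintype.equivFin (Set.range φ)
  exact ⟨_, fun j => R (e.symm j), fun F => ⟨e ⟨φ F, F, rfl⟩, hiso _ _ (by simp [hR])⟩⟩

end FlatConnection

/-! ### Semisimple linear categories -/

namespace CategoryTheory

/-- A retract in a preadditive category with kernels is a direct summand, complemented by the
kernel of the retraction. -/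
noncomputable def isoBiprodKernelOfRetraction {A : Type*} [Category* A] [Preadditive A]
    [HasKernels A] [HasBinaryBiproducts A] {X Y : A}
    (f : Y ⟶ X) (r : X ⟶ Y) (h : f ≫ r = 𝟙 Y) : X ≅ Y ⊞ kernel r where
  hom := biprod.lift r (kernel.lift r (𝟙 X - r ≫ f) (by simp [h]))
  inv := biprod.desc f (kernel.ι r)
  hom_inv_id := by simp [biprod.lift_desc]
  inv_hom_id := by
    refine biprod.hom_ext' _ _ (biprod.hom_ext _ _ ?_ ?_) (biprod.hom_ext _ _ ?_ ?_)
    · simp [h]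
    · rw [← cancel_mono (kernel.ι r)]
      simp [reassoc_of% h]
    · simp
    · rw [← cancel_mono (kernel.ι r)]
      simp

/-- The binary biproduct of two finite biproducts is a finite biproduct. -/
noncomputable def biprodBiproductIso {A : Type*} [Category* A] [Preadditive A]
    [HasFiniteBiproducts A] [HasBinaryBiproducts A] {m n : ℕ} (f : Fin m ⊕ Fin n → A) :
    (⨁ fun i => f (.inl i)) ⊞ (⨁ fun i => f (.inr i)) ≅ ⨁ f where
  hom := biproduct.lift (Sum.rec (fun i => biprod.fst ≫ biproduct.π (fun i => f (.inl i)) i)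
    fun i => biprod.snd ≫ biproduct.π (fun i => f (.inr i)) i)
  inv := biprod.lift (biproduct.lift fun i => biproduct.π f (.inl i))
    (biproduct.lift fun i => biproduct.π f (.inr i))
  hom_inv_id := by
    refine biprod.hom_ext _ _ (biproduct.hom_ext _ _ fun i => ?_)
      (biproduct.hom_ext _ _ fun i => ?_) <;> simp
  inv_hom_id := by
    refine biproduct.hom_ext _ _ fun i => ?_
    rcases i with i | i <;> simp

variable {A : Type*} [Category* A] [Preadditive A] [Linear ℂ A]

/-- In a hom-finite category a direct summand with nonzero complement has an endomorphism ring of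
smaller dimension. -/
theorem finrank_end_lt_of_iso_biprod [HasBinaryBiproducts A]
    [∀ X Y : A, FiniteDimensional ℂ (X ⟶ Y)] {X Y Z : A}
    (e : X ≅ Y ⊞ Z) (hZ : ¬ IsZero Z) :
    Module.finrank ℂ (Y ⟶ Y) < Module.finrank ℂ (X ⟶ X) := by
  let φ : (Y ⟶ Y) × (Z ⟶ Z) →ₗ[ℂ] (X ⟶ X) :=
    { toFun := fun p => e.hom ≫ biprod.map p.1 p.2 ≫ e.inv
      map_add' := fun p q => by
        rw [← Preadditive.comp_add, ← Preadditive.add_comp]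
        congr 2
        ext <;> simp
      map_smul' := fun c p => by
        rw [RingHom.id_apply, ← Linear.comp_smul, ← Linear.smul_comp]
        congr 2
        ext <;> simp }
  have hφ : Function.Injective φ := by
    rintro ⟨a, b⟩ ⟨a', b'⟩ h
    have h1 : biprod.map a b = biprod.map a' b' := by
      simpa [φ, cancel_epi, cancel_mono] using h
    refine Prod.ext ?_ ?_
    · simpa using biprod.inl ≫= h1 =≫ biprod.fst
    · simpa using biprod.inr ≫= h1 =≫ biprod.snd
  have hle := LinearMap.finrank_le_finrank_of_injective hφ
  rw [Module.finrank_prod] at hle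
  have : 0 < Module.finrank ℂ (Z ⟶ Z) := by
    rw [Module.finrank_pos_iff_exists_ne_zero]
    exact ⟨𝟙 Z, fun h => hZ ((IsZero.iff_id_eq_zero Z).2 h)⟩
  omega

/-- If all monomorphisms of a hom-finite abelian category split, every object is a finite biproduct
of simple objects. -/
theorem exists_iso_biproduct_simple [HasKernels A] [HasFiniteBiproducts A]
    [∀ X Y : A, FiniteDimensional ℂ (X ⟶ Y)]
    (hA : ∀ {X Y : A} (f : X ⟶ Y) [Mono f], IsSplitMono f) (X : A) :
    ∃ (n : ℕ) (T : Fin n → A), (∀ i, Simple (T i)) ∧ Nonempty (X ≅ ⨁ T) := by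
  have := hasBinaryBiproducts_of_finite_biproducts A
  induction hd : Module.finrank ℂ (X ⟶ X) using Nat.strong_induction_on generalizing X with
  | _ d ih =>
  subst hd
  by_cases h0 : IsZero X
  · refine ⟨0, Fin.elim0, fun i : Fin 0 => i.elim0, ⟨h0.iso ?_⟩⟩
    rw [IsZero.iff_id_eq_zero]
    exact biproduct.hom_ext _ _ fun i => i.elim0
  by_cases hs : Simple X
  · exact ⟨1, fun _ => X, fun _ => hs, ⟨(biproductUniqueIso fun _ : Fin 1 => X).symm⟩⟩
  obtain ⟨Y, f, hf, hf0, hfi⟩ : ∃ (Y : A) (f : Y ⟶ X), Mono f ∧ f ≠ 0 ∧ ¬ IsIso f := by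
    by_contra! hcon
    refine hs ⟨fun {Y} f hf => ⟨fun hi h => h0 ?_, fun h => hcon Y f hf h⟩⟩
    subst h
    exact IsZero.of_epi (0 : Y ⟶ X) ((IsZero.iff_id_eq_zero Y).2
      ((cancel_mono (0 : Y ⟶ X)).1 (by simp)))
  have := hA f
  let e := isoBiprodKernelOfRetraction f (retraction f) (IsSplitMono.id f)
  have hY : ¬ IsZero Y := fun h => hf0 (h.eq_of_src _ _)
  have hZ : ¬ IsZero (kernel (retraction f)) := fun h => hfi <| by
    have : Mono (retraction f) := Preadditive.mono_of_kernel_zero (h.eq_of_src _ _)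
    have := isIso_of_mono_of_isSplitEpi (retraction f)
    exact IsIso.of_isIso_fac_right (IsSplitMono.id f)
  obtain ⟨m, S, hS, ⟨eS⟩⟩ := ih _ (finrank_end_lt_of_iso_biprod e hZ) Y rfl
  obtain ⟨n, T, hT, ⟨eT⟩⟩ :=
    ih _ (finrank_end_lt_of_iso_biprod (e ≪≫ biprod.braiding _ _) hY) _ rfl
  refine ⟨m + n, Sum.elim S T ∘ finSumFinEquiv.symm, fun i => ?_, ⟨e ≪≫ biprod.mapIso eS eT ≪≫
    biprodBiproductIso (Sum.elim S T) ≪≫ biproduct.whiskerEquiv finSumFinEquiv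
      fun j => eqToIso (by simp)⟩⟩
  rcases h : finSumFinEquiv.symm i with j | j
  · simpa [h] using hS j
  · simpa [h] using hT j

/-- A hom-finite `ℂ`-linear abelian category in which monomorphisms split is a Kapranov–Voevodsky
2-vector space as soon as a finite family of objects detects nonzero objects: every simple object
is then a constituent of a member of that family. -/
theorem isKV2VectorSpace_of_isSplitMono [HasKernels A] [HasFiniteBiproducts A]
    [∀ X Y : A, FiniteDimensional ℂ (X ⟶ Y)]
    (hA : ∀ {X Y : A} (f : X ⟶ Y) [Mono f], IsSplitMono f) {m : ℕ} (P : Fin m → A)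
    (hP : ∀ X : A, ¬ IsZero X → ∃ i, ∃ f : P i ⟶ X, f ≠ 0) : IsKV2VectorSpace A := by
  choose n T hT e using fun i => exists_iso_biproduct_simple hA (P i)
  let S : (Σ i, Fin (n i)) → A := fun j => T j.1 j.2
  have hS : ∀ j, Simple (S j) := fun j => hT _ _
  have hex : ∀ X : A, Simple X → ∃ j, Nonempty (X ≅ S j) := by
    intro X hX
    obtain ⟨i, f, hf⟩ := hP X (Simple.not_isZero X)
    obtain ⟨k, hk⟩ : ∃ k, biproduct.ι (T i) k ≫ (e i).some.inv ≫ f ≠ 0 := by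
      by_contra! h
      refine hf ((cancel_epi (e i).some.inv).1 (biproduct.hom_ext' _ _ fun k => ?_))
      simpa using h k
    have := hT i k
    have := isIso_of_hom_simple hk
    exact ⟨⟨i, k⟩, ⟨(asIso (biproduct.ι (T i) k ≫ (e i).some.inv ≫ f)).symm⟩⟩
  let s : Setoid (Σ i, Fin (n i)) :=
    { r := fun j j' => Nonempty (S j ≅ S j')
      iseqv := ⟨fun _ => ⟨Iso.refl _⟩, fun ⟨a⟩ => ⟨a.symm⟩, fun ⟨a⟩ ⟨b⟩ => ⟨a ≪≫ b⟩⟩ }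
  obtain ⟨k, ⟨q⟩⟩ := Finite.exists_equiv_fin (_root_.Quotient s)
  refine { exists_basis := ⟨k, fun a => S (q.symm a).out, fun a => ?_, fun a b hab f => ?_,
    fun X => ?_⟩ }
  · have := hS (q.symm a).out
    refine FiniteDimensional.nonempty_linearEquiv_of_finrank_eq ?_
    rw [finrank_endomorphism_simple_eq_one ℂ, Module.finrank_self]
  · by_contra hf
    have := hS (q.symm a).out
    have := hS (q.symm b).out
    have := isIso_of_hom_simple hf
    exact hab (q.symm.injective (_root_.Quotient.out_equiv_out.1 ⟨asIso f⟩))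
  · obtain ⟨l, R, hR, ⟨eR⟩⟩ := exists_iso_biproduct_simple hA X
    choose j hj using fun i => hex (R i) (hR i)
    refine ⟨l, fun i => q (_root_.Quotient.mk s (j i)),
      ⟨eR ≪≫ biproduct.mapIso fun i => (hj i).some ≪≫ ?_⟩⟩
    exact Nonempty.some (by
      dsimp only
      rw [Equiv.symm_apply_apply]
      exact Setoid.symm (_root_.Quotient.mk_out (s := s) (j i)))

end CategoryTheory

/-! ### Representations of finite groupoids -/

namespace CategoryTheory

variable {C : Type*} [Category* C]

/-- Maschke's theorem for a groupoid with finite hom sets and finitely many isomorphism classes: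
pointwise retractions are averaged over all morphisms to a finite family of representatives. Using
all representatives at once makes the average natural without choosing a representative for each
object. -/
theorem isSplitMono_functor_of_finite [IsGroupoid C] [∀ x y : C, Finite (x ⟶ y)]
    {D : Type*} [Category* D] [Preadditive D] [Linear ℂ D]
    [HasPullbacks D] (hD : ∀ {X Y : D} (f : X ⟶ Y) [Mono f], IsSplitMono f)
    {ι : Type*} [Finite ι] (b : ι → C) (hb : ∀ x, ∃ i, Nonempty (x ⟶ b i))
    {F F' : C ⥤ D} (f : F ⟶ F') [Mono f] : IsSplitMono f := by
  have hf := (NatTrans.mono_iff_mono_app f).1 inferInstance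
  have hs := fun x => hD (f.app x)
  have := fun x => Fintype.ofFinite (Σ i, (x ⟶ b i))
  let N : C → ℂ := fun x => Fintype.card (Σ i, (x ⟶ b i))
  have hN : ∀ x, N x ≠ 0 := fun x => by
    obtain ⟨i, ⟨g⟩⟩ := hb x
    have : Nonempty (Σ i, (x ⟶ b i)) := ⟨⟨i, g⟩⟩
    exact Nat.cast_ne_zero.2 Fintype.card_ne_zero
  let R : ∀ x, F'.obj x ⟶ F.obj x := fun x => (N x)⁻¹ • ∑ p : Σ i, (x ⟶ b i),
    F'.map p.2 ≫ retraction (f.app (b p.1)) ≫ F.map (inv p.2)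
  have hR : ∀ {x y : C} (h : x ⟶ y), F'.map h ≫ R y = R x ≫ F.map h := by
    intro x y h
    have hterm : ∀ i (q : y ⟶ b i),
        F'.map h ≫ F'.map q ≫ retraction (f.app (b i)) ≫ F.map (inv q) =
          (F'.map (h ≫ q) ≫ retraction (f.app (b i)) ≫ F.map (inv (h ≫ q))) ≫ F.map h := by
      intro i q
      simp only [F'.map_comp, IsIso.inv_comp, Category.assoc, ← F.map_comp,
        IsIso.inv_hom_id, Category.comp_id]
    let e : (Σ i, (y ⟶ b i)) ≃ (Σ i, (x ⟶ b i)) :=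
      Equiv.sigmaCongrRight fun i => (asIso h).symm.homFromEquiv
    have hNe : N y = N x := by simp only [N, Fintype.card_congr e]
    simp only [R, Linear.comp_smul, Linear.smul_comp, Preadditive.comp_sum, Preadditive.sum_comp,
      hNe]
    congr 1
    refine Fintype.sum_equiv e _ _ fun q => ?_
    exact hterm q.1 q.2
  refine ⟨⟨{ app := R, naturality := fun _ _ h => hR h }, ?_⟩⟩
  refine NatTrans.ext (funext fun x => ?_)
  have hterm : ∀ p : Σ i, (x ⟶ b i),
      f.app x ≫ F'.map p.2 ≫ retraction (f.app (b p.1)) ≫ F.map (inv p.2) = 𝟙 (F.obj x) :=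
    fun p => by
      rw [← f.naturality_assoc, IsSplitMono.id_assoc, ← F.map_comp, IsIso.hom_inv_id, F.map_id]
  simp only [NatTrans.comp_app, NatTrans.id_app, R, Linear.comp_smul, Preadditive.comp_sum, hterm]
  rw [Finset.sum_const, Finset.card_univ, ← Nat.cast_smul_eq_nsmul ℂ, smul_smul,
    inv_mul_cancel₀ (hN x), one_smul]

/-- The linearisation of the functor corepresented by `c`. The finite hom sets are replaced by
equivalent types in the universe of the category of vector spaces. -/
noncomputable def freeCoyoneda [∀ x y : C, Finite (x ⟶ y)] (c : C) :
    C ⥤ FGModuleCat.{0} ℂ where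
  obj x := FGModuleCat.of ℂ (Shrink.{0} (c ⟶ x) →₀ ℂ)
  map {x y} f := FGModuleCat.ofHom (Finsupp.lmapDomain ℂ ℂ
    fun g : Shrink.{0} (c ⟶ x) => equivShrink.{0} (c ⟶ y) ((equivShrink.{0} _).symm g ≫ f))
  map_id x := FGModuleCat.hom_ext <| by
    refine Finsupp.lhom_ext' fun g => LinearMap.ext_ring ?_
    change Finsupp.mapDomain (fun g : Shrink.{0} (c ⟶ x) =>
      equivShrink.{0} (c ⟶ x) ((equivShrink.{0} _).symm g ≫ 𝟙 x)) (Finsupp.single g 1) =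
        Finsupp.single g 1
    simp
  map_comp {x y z} f h := FGModuleCat.hom_ext <| by
    refine Finsupp.lhom_ext' fun g => LinearMap.ext_ring ?_
    change Finsupp.mapDomain (fun g' : Shrink.{0} (c ⟶ x) =>
      equivShrink.{0} (c ⟶ z) ((equivShrink.{0} _).symm g' ≫ f ≫ h)) (Finsupp.single g 1) =
        Finsupp.mapDomain (fun g' : Shrink.{0} (c ⟶ y) =>
          equivShrink.{0} (c ⟶ z) ((equivShrink.{0} _).symm g' ≫ h)) (Finsupp.mapDomain
          (fun g' : Shrink.{0} (c ⟶ x) =>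
            equivShrink.{0} (c ⟶ y) ((equivShrink.{0} _).symm g' ≫ f)) (Finsupp.single g 1))
    simp

/-- Yoneda: a vector `v` of `F.obj c` is the image of the identity under a morphism from the
linearised corepresentable functor, so that this functor detects whether `F.obj c` vanishes. -/
theorem exists_freeCoyoneda_hom_ne_zero [∀ x y : C, Finite (x ⟶ y)]
    (c : C) (F : C ⥤ FGModuleCat.{0} ℂ) (hF : ¬ IsZero (F.obj c)) :
    ∃ f : freeCoyoneda c ⟶ F, f ≠ 0 := by
  obtain ⟨v, hv⟩ : ∃ v : F.obj c, v ≠ 0 := by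
    by_contra! h
    refine hF ((IsZero.iff_id_eq_zero _).2 (FGModuleCat.hom_ext (LinearMap.ext h)))
  let φ : ∀ x, (Shrink.{0} (c ⟶ x) →₀ ℂ) →ₗ[ℂ] F.obj x := fun x =>
    Finsupp.linearCombination ℂ fun g => (F.map ((equivShrink.{0} _).symm g)).hom.hom v
  let f : freeCoyoneda c ⟶ F :=
    { app := fun x => FGModuleCat.ofHom (φ x)
      naturality := fun x y h => FGModuleCat.hom_ext <| by
        refine Finsupp.lhom_ext' fun g => LinearMap.ext_ring ?_
        change φ y (Finsupp.mapDomain (fun g' : Shrink.{0} (c ⟶ x) =>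
          equivShrink.{0} (c ⟶ y) ((equivShrink.{0} _).symm g' ≫ h)) (Finsupp.single g 1)) =
            (F.map h).hom.hom (φ x (Finsupp.single g 1))
        simp [φ] }
  refine ⟨f, fun h => hv ?_⟩
  have h1 : φ c (Finsupp.single (equivShrink.{0} _ (𝟙 c)) 1) = 0 := LinearMap.congr_fun
    (congrArg (fun ψ : freeCoyoneda c ⟶ F => (ψ.app c).hom.hom) h) _
  simpa [φ] using h1

/-- Linear retractions of injective maps exist. -/
theorem isSplitMono_fgModuleCat {X Y : FGModuleCat.{0} ℂ} (f : X ⟶ Y) [Mono f] :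
    IsSplitMono f := by
  have h : Function.Injective f.hom.hom := (ModuleCat.mono_iff_injective
    ((forget₂ (FGModuleCat ℂ) (ModuleCat ℂ)).map f)).1 inferInstance
  obtain ⟨g, hg⟩ := LinearMap.exists_leftInverse_of_injective f.hom.hom (LinearMap.ker_eq_bot.2 h)
  exact ⟨⟨FGModuleCat.ofHom g, FGModuleCat.hom_ext hg⟩⟩

/-- A natural transformation is determined by its components at the finitely many representatives
of the isomorphism classes, which are linear maps between finite-dimensional spaces. -/
theorem finiteDimensional_natTrans [IsGroupoid C] {ι : Type*} [Finite ι] (b : ι → C)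
    (hb : ∀ x, ∃ i, Nonempty (x ⟶ b i)) (F F' : C ⥤ FGModuleCat.{0} ℂ) :
    FiniteDimensional ℂ (F ⟶ F') := by
  refine FiniteDimensional.of_injective
    (LinearMap.pi fun i => NatTrans.appLinearMap (R := ℂ) (F := F) (G := F') (b i)) fun η η' h => ?_
  refine NatTrans.ext (funext fun x => ?_)
  obtain ⟨i, ⟨g⟩⟩ := hb x
  have hi : η.app (b i) = η'.app (b i) := congrFun h i
  rw [← cancel_mono (F'.map g), ← η.naturality, ← η'.naturality, hi]

/-- The finite-dimensional representations of a groupoid with finite hom sets and finitely many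
isomorphism classes form a Kapranov–Voevodsky 2-vector space. -/
theorem isKV2VectorSpace_functor_of_finite [IsGroupoid C]
    [∀ x y : C, Finite (x ⟶ y)] {m : ℕ} (b : Fin m → C)
    (hb : ∀ x, ∃ i, Nonempty (x ≅ b i)) : IsKV2VectorSpace (C ⥤ FGModuleCat.{0} ℂ) := by
  have hb' : ∀ x, ∃ i, Nonempty (x ⟶ b i) := fun x => (hb x).imp fun _ ⟨e⟩ => ⟨e.hom⟩
  have := finiteDimensional_natTrans b hb'
  have : HasFiniteBiproducts (C ⥤ FGModuleCat.{0} ℂ) := .of_hasFiniteProducts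
  refine isKV2VectorSpace_of_isSplitMono
    (fun f _ => isSplitMono_functor_of_finite (fun f _ => isSplitMono_fgModuleCat f) b hb' f)
    (fun i => freeCoyoneda (b i)) fun F hF => ?_
  obtain ⟨i, hi⟩ : ∃ i, ¬ IsZero (F.obj (b i)) := by
    by_contra! h
    refine hF (Functor.isZero _ fun x => ?_)
    obtain ⟨i, ⟨e⟩⟩ := hb x
    exact (h i).of_iso (F.mapIso e)
  exact ⟨i, exists_freeCoyoneda_hom_ne_zero _ F hi⟩

end CategoryTheory

/-! ### The 2-vector space of flat connections -/

/-- `B` is a compact Hausdorff topological manifold of finite dimension, possibly with boundary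
and corners (the model with corners `I`); it may be empty or disconnected. -/
theorem mainTheorem10 {E : Type*} [NormedAddCommGroup E] [NormedSpace ℝ E]
    [FiniteDimensional ℝ E] {H : Type*} [TopologicalSpace H] (I : ModelWithCorners ℝ E H)
    (B : Type*) [TopologicalSpace B] [ChartedSpace H B] [IsManifold I 0 B]
    [T2Space B] [CompactSpace B]
    (G : Type*) [Group G] [Finite G] :
    IsKV2VectorSpace (ZG G B) := by
  obtain ⟨n, U, hUo, hUs, hU, hUU⟩ := exists_finite_cover_isSimplyConnected fun (x : B) O hO =>
    exists_isSimplyConnected_subset_of_chartedSpace I x hO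
  obtain ⟨hfin, m, R, hR⟩ := FlatConnection.exists_finite_representatives (G := G) hUo hUs hU hUU
  have : IsGroupoid (FlatConnection B G) := ⟨fun f => NatIso.isIso_of_isIso_app f⟩
  exact isKV2VectorSpace_functor_of_finite R hR
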